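/- Let $n\ge 1$ and $D_M\ge 0$ be integers and let $H\in\mathbb{R}^{n\times n}$ be symmetric positive definite. Consider the unknown map $Q(\theta)=Q^*+\tfrac12(\theta-\theta^*)^TH(\theta-\theta^*)$ with $\theta^*\in\mathbb{R}^n$, $Q^*\in\mathbb{R}$, and the delayed measurements $y(j)=0$ for $0\le j<D_M$, $y(j)=Q(\theta(j-D(j)))$ for $j\ge D_M$, where the unknown integer delay satisfies $0\le D(j)\le D_M$. For $\varepsilon>0$ put $$T=\max\{n\max(D_M,1)\lfloor 1/\sqrt{\varepsilon}\rfloor,\,2n+1\},\quad \omega_i=\frac{2\pi i}{T},\quad S_i(j)=a_i\sin(\omega_i j),\quad M_i(j)=\frac{2}{a_i}\sin(\omega_i j)\quad(1\le i\le n),$$ and $\alpha(j)=\alpha_0(1-\varepsilon\lambda)^j$. The unbiased extremum seeking algorithm is $$\theta(j)=\theta(0)\ (0\le j\le D_M),\qquad \theta(j)=\hat\theta(j)+\alpha(j)S(j)\ (j>D_M),$$ $$\hat\theta(j)=\theta(0)\ (0\le j\le D_M),\qquad \hat\theta(j+1)=\hat\theta(j)-\varepsilon\frac{kM(j)}{\alpha(j)}[y(j)-\eta(j)]\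 (j\ge D_M),$$ $$\eta(D_M)=Q_0,\qquad \eta(j+1)=\eta(j)+\varepsilon\omega_h[y(j)-\eta(j)]\ (j\ge D_M).$$ Let $\sigma_0>0$, $\Delta_Q>0$, let $a_1,\dots,a_n$ be non-zero reals, and let $\alpha_0,k,\lambda,\omega_h>0$ satisfy $kH>\lambda I$ and $\omega_h>2\lambda$. Then $\omega_i=O(\sqrt{\varepsilon})$ as $\varepsilon\to0^+$ for every $i$, and the estimation error system for $\tilde\theta=\hat\theta-\theta^*$, $\tilde\eta=\eta-Q^*$ is exponentially stable for all sufficiently small $\varepsilon$: there are $\varepsilon^*>0$, $\sigma>0$ and $\sigma_\eta>0$ such that, for all $\varepsilon\in(0,\varepsilon^*]$, one has $0<1-\varepsilon\lambda<1$ and $$|\tilde\theta(j)|<\sigma(1-\varepsilon\lambda)^j,\qquad |\tilde\eta(j)|<\sigma_\eta(1-\varepsilon\lambda)^{2j},\qquad j\ge D_M,$$ for every delay sequence with $0\le D(j)\le D_M$, all $\theta^*,Q^*$, and all initial data with $|\theta(0)-\theta^*|\le\sigma_0$ and $|Q_0-Q^*|\le\Delta_Q$. -/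

import Mathlib

open Filter Topology Asymptotics
open scoped Matrix

noncomputable section

namespace UnbiasedES

/-- The weighted square `|x|_H^2 = xᵀ H x`. -/
def wsq {n : ℕ} (H : Matrix (Fin n) (Fin n) ℝ) (x : EuclideanSpace ℝ (Fin n)) : ℝ :=
  x.ofLp ⬝ᵥ (H *ᵥ x.ofLp)

/-- The quadratic map `Q(θ) = Q* + |θ - θ*|_H^2 / 2`. -/
structure QuadMap (n : ℕ) where
  /-- Hessian -/
  H : Matrix (Fin n) (Fin n) ℝ
  /-- extremum point -/
  θs : EuclideanSpace ℝ (Fin n)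
  /-- extremum value -/
  Qs : ℝ

/-- The value of the quadratic map at `θ`. -/
def QuadMap.eval {n : ℕ} (F : QuadMap n) (θ : EuclideanSpace ℝ (Fin n)) : ℝ :=
  F.Qs + 1 / 2 * wsq F.H (θ - F.θs)

/-- The dither period `T = max {n D_M ⌊1/√ε⌋, 2n+1}`. -/
def period (n D_M : ℕ) (ε : ℝ) : ℕ :=
  max (n * D_M * ⌊1 / √ε⌋₊) (2 * n + 1)

/-- The dither frequencies `ω_i = 2πi/T`, `i = 1, …, n` (the index `i : Fin n` starts at `0`). -/
def frequency (n D_M : ℕ) (ε : ℝ) (i : Fin n) : ℝ :=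
  2 * Real.pi * ((i : ℝ) + 1) / (period n D_M ε : ℝ)

/-- The parameters of the unbiased extremum seeking algorithm. -/
structure Tuning (n : ℕ) where
  /-- bound on the measurement delay -/
  D_M : ℕ
  /-- dither amplitudes -/
  a : Fin n → ℝ
  /-- dither frequencies -/
  ω : Fin n → ℝ
  /-- initial value of the decaying gain -/
  α₀ : ℝ
  /-- adaptation gain -/
  k : ℝ
  /-- decay parameter `λ` -/
  lam : ℝ
  /-- high-pass filter gain -/
  ωh : ℝ
  /-- small parameter -/
  ε : ℝ

namespace Tuning

variable {n : ℕ} (P : Tuning n)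

/-- The decay rate `1 - ελ`. -/
def rate : ℝ := 1 - P.ε * P.lam

/-- The exponentially decaying function `α(j) = α₀ (1 - ελ)^j`. -/
def α (j : ℕ) : ℝ := P.α₀ * P.rate ^ j

/-- The perturbation vector, `S_i(j) = a_i sin(ω_i j)`. -/
def S (j : ℕ) : EuclideanSpace ℝ (Fin n) :=
  WithLp.toLp 2 fun i => P.a i * Real.sin (P.ω i * j)

/-- The demodulation vector, `M_i(j) = (2 / a_i) sin(ω_i j)`. -/
def M (j : ℕ) : EuclideanSpace ℝ (Fin n) :=
  WithLp.toLp 2 fun i => 2 / P.a i * Real.sin (P.ω i * j)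

/-- The input `θ(j)` applied to the map: constant for `j ≤ D_M`, then estimate plus dither. -/
def input (θ₀ : EuclideanSpace ℝ (Fin n)) (θhat : ℕ → EuclideanSpace ℝ (Fin n)) (j : ℕ) :
    EuclideanSpace ℝ (Fin n) :=
  if j ≤ P.D_M then θ₀ else θhat j + P.α j • P.S j

/-- The delayed measurement `y(j)`: zero for `j < D_M`, then `Q(θ(j - D(j)))`. -/
def output (F : QuadMap n) (D : ℕ → ℕ) (θ₀ : EuclideanSpace ℝ (Fin n))
    (θhat : ℕ → EuclideanSpace ℝ (Fin n)) (j : ℕ) : ℝ :=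
  if j < P.D_M then 0 else F.eval (P.input θ₀ θhat (j - D j))

/-- `(θhat, η)` is the trajectory of the unbiased extremum seeking algorithm for the map `F` with
measurement delay `D`, initial input `θ₀` and initial filter state `Q₀`. The values of `η` before
time `D_M` play no role. -/
structure IsTrajectory (F : QuadMap n) (D : ℕ → ℕ) (θ₀ : EuclideanSpace ℝ (Fin n)) (Q₀ : ℝ)
    (θhat : ℕ → EuclideanSpace ℝ (Fin n)) (η : ℕ → ℝ) : Prop where
  θhat_init : ∀ j ≤ P.D_M, θhat j = θ₀
  θhat_step : ∀ j ≥ P.D_M,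
    θhat (j + 1) =
      θhat j - (P.ε * (P.k / P.α j) * (P.output F D θ₀ θhat j - η j)) • P.M j
  η_init : η P.D_M = Q₀
  η_step : ∀ j ≥ P.D_M,
    η (j + 1) = η j + P.ε * P.ωh * (P.output F D θ₀ θhat j - η j)

/-- Exponential stability of the estimation errors `θhat - θ*`, `η - Q*`, with decay rate
`1 - ελ ∈ (0, 1)` and bounds `σ`, `ση`, for the Hessian `H`: uniformly over all delays
`0 ≤ D(j) ≤ D_M`, all extremum points and values of the map, and all initial data with
`|θ(0) - θ*| ≤ σ₀`, `|Q₀ - Q*| ≤ ΔQ`. -/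
def IsExpStable (H : Matrix (Fin n) (Fin n) ℝ) (σ₀ ΔQ σ ση : ℝ) : Prop :=
  0 < P.rate ∧ P.rate < 1 ∧
  ∀ (F : QuadMap n), F.H = H →
  ∀ (D : ℕ → ℕ), (∀ j, D j ≤ P.D_M) →
  ∀ (θ₀ : EuclideanSpace ℝ (Fin n)) (Q₀ : ℝ), ‖θ₀ - F.θs‖ ≤ σ₀ → |Q₀ - F.Qs| ≤ ΔQ →
  ∀ (θhat : ℕ → EuclideanSpace ℝ (Fin n)) (η : ℕ → ℝ), P.IsTrajectory F D θ₀ Q₀ θhat η →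
  ∀ j ≥ P.D_M,
    ‖θhat j - F.θs‖ < σ * P.rate ^ j ∧ |η j - F.Qs| < ση * P.rate ^ (2 * j)

end Tuning

end UnbiasedES

end

/-! Divide the estimate error by `α(j)` and the filter error by `α(j) ^ 2`. Since `Q - Q*` is
homogeneous of degree two, the scaled recursion has constant coefficients, and exponential stability
becomes boundedness of the scaled errors `z` and `w`.

The scaled demodulated signal is `A z` plus a zero-mean oscillation, which is linear in a few slow
features `ξ` of the state. Its partial sums `Φ` are operators of size `O(T)`, so `v = z + εk Φ ξ`
differs from `z` by `O(εT) = O(√ε)`. In this coordinate one step is `v - ε K v` plus `ε` times a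
small error, where `K = kA - λ` is coercive because `kH > λI`: a contraction
(`norm_averaged_step_le`). A delay of at most `D_M` steps is harmless because gain, estimate and
dither barely move during it; for the dither this is `ω = O(√ε)`. The filter state stays bounded
because `ωh > 2λ`.

All these estimates presuppose the bounds being proved, so `IsNormalizedRun.boundedUpTo` closes them
by induction on time. The constants depend on `H`, the gains and the sizes of the initial errors,
not on `θ*`, `Q*` or the delay sequence, whence the uniformity. -/

noncomputable section Averaging

/-! ### Averaging: contraction, and the oscillating part of the demodulated signal. -/

open Finset

variable {E : Type*} [NormedAddCommGroup E] [InnerProductSpace ℝ E]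

/-- The partial sums of a bounded periodic sequence with zero mean are bounded by the bound times
the period. -/
theorem norm_sum_range_le_of_periodic {V : Type*} [SeminormedAddCommGroup V]
    (f : ℕ → V) (T : ℕ) (hT : 0 < T) (C : ℝ) (hC : ∀ j, ‖f j‖ ≤ C) (hper : ∀ j, f (j + T) = f j)
    (hsum : ∑ j ∈ range T, f j = 0) (j : ℕ) : ‖∑ i ∈ range j, f i‖ ≤ C * T := by
  have hC0 : 0 ≤ C := (norm_nonneg _).trans (hC 0)
  induction j using Nat.strong_induction_on with
  | _ j ih =>
    by_cases hj : j < T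
    · calc ‖∑ i ∈ range j, f i‖ ≤ ∑ i ∈ range j, C := norm_sum_le_of_le _ fun i _ => hC i
        _ = C * j := by simp [mul_comm]
        _ ≤ C * T := by gcongr
    · obtain ⟨m, rfl⟩ := Nat.exists_eq_add_of_le (not_lt.mp hj)
      rw [sum_range_add, hsum, zero_add]
      have : ∑ x ∈ range m, f (T + x) = ∑ x ∈ range m, f x :=
        sum_congr rfl fun x _ => by rw [add_comm, hper]
      rw [this]
      exact ih m (by omega)

/-- Increments of a quadratic form. -/
theorem abs_inner_apply_self_sub_le (A : E →L[ℝ] E) (x y : E) :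
    |inner ℝ x (A x) - inner ℝ y (A y)| ≤ ‖A‖ * ‖x - y‖ * (‖x‖ + ‖y‖) := by
  have h : inner ℝ x (A x) - inner ℝ y (A y) =
      inner ℝ x (A (x - y)) + inner ℝ (x - y) (A y) := by
    rw [map_sub, inner_sub_right, inner_sub_left]; ring
  rw [h]
  have h1 : |inner ℝ x (A (x - y))| ≤ ‖x‖ * (‖A‖ * ‖x - y‖) :=
    (abs_real_inner_le_norm _ _).trans (by gcongr; exact A.le_opNorm _)
  have h2 : |inner ℝ (x - y) (A y)| ≤ ‖x - y‖ * (‖A‖ * ‖y‖) :=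
    (abs_real_inner_le_norm _ _).trans (by gcongr; exact A.le_opNorm _)
  refine (abs_add_le _ _).trans ?_
  nlinarith

theorem abs_inner_apply_self_le (A : E →L[ℝ] E) (x : E) :
    |inner ℝ x (A x)| ≤ ‖A‖ * ‖x‖ ^ 2 := by
  have := abs_inner_apply_self_sub_le A x 0
  simp only [inner_zero_left, sub_zero, norm_zero, add_zero] at this
  nlinarith

/-- A small gradient step along a coercive operator is a contraction. -/
theorem norm_sub_smul_apply_le (K : E →L[ℝ] E) {c ε : ℝ}
    (hK : ∀ x, 2 * c * ‖x‖ ^ 2 ≤ inner ℝ x (K x)) (hε : 0 ≤ ε) (hε1 : ε * ‖K‖ ^ 2 ≤ 2 * c)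
    (hε2 : ε * c ≤ 1) (x : E) : ‖x - ε • K x‖ ≤ (1 - ε * c) * ‖x‖ := by
  have h1 : ‖x - ε • K x‖ ^ 2 = ‖x‖ ^ 2 - 2 * (ε * inner ℝ x (K x)) + ε ^ 2 * ‖K x‖ ^ 2 := by
    rw [norm_sub_sq_real, inner_smul_right, norm_smul, mul_pow, Real.norm_eq_abs, sq_abs]
  have h2 : ‖K x‖ ^ 2 ≤ ‖K‖ ^ 2 * ‖x‖ ^ 2 := by
    rw [← mul_pow]; gcongr; exact K.le_opNorm x
  -- Half of the decrease `4εc‖x‖²` absorbs the second-order term; then `1 - 2εc ≤ (1 - εc)²`.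
  have h3 : ε ^ 2 * ‖K x‖ ^ 2 ≤ ε * (2 * c) * ‖x‖ ^ 2 := by
    calc ε ^ 2 * ‖K x‖ ^ 2 ≤ ε ^ 2 * (‖K‖ ^ 2 * ‖x‖ ^ 2) := by gcongr
      _ = ε * (ε * ‖K‖ ^ 2) * ‖x‖ ^ 2 := by ring
      _ ≤ _ := by gcongr
  refine abs_le_of_sq_le_sq' ?_ (mul_nonneg (by linarith) (norm_nonneg _)) |>.2
  rw [h1, mul_pow]
  nlinarith [mul_le_mul_of_nonneg_left (hK x) hε, mul_nonneg (sq_nonneg (ε * c)) (sq_nonneg ‖x‖)]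

/-- The zero-mean part of the demodulated signal, linear in the slow features. -/
def demodulated (A : E →L[ℝ] E) (s m : E) : ℝ × E × ℝ →L[ℝ] E :=
  (ContinuousLinearMap.fst ℝ ℝ (E × ℝ)).smulRight m +
  (((innerSL ℝ s).comp ((ContinuousLinearMap.fst ℝ E ℝ).comp
      (ContinuousLinearMap.snd ℝ ℝ (E × ℝ)))).smulRight m -
    (ContinuousLinearMap.fst ℝ E ℝ).comp (ContinuousLinearMap.snd ℝ ℝ (E × ℝ))) +
  ((ContinuousLinearMap.snd ℝ E ℝ).comp (ContinuousLinearMap.snd ℝ ℝ (E × ℝ))).smulRight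
    ((1 / 2 * inner ℝ s (A s)) • m)

theorem demodulated_apply (A : E →L[ℝ] E) (s m u : E) (q t : ℝ) :
    demodulated A s m (q, u, t) =
      q • m + (inner ℝ s u • m - u) + t • (1 / 2 * inner ℝ s (A s)) • m := by
  simp [demodulated]

theorem norm_demodulated_le (A : E →L[ℝ] E) (s m : E) {b c : ℝ} (hs : ‖s‖ ≤ b) (hm : ‖m‖ ≤ c) :
    ‖demodulated A s m‖ ≤ c + (b * c + 1) + ‖A‖ * b ^ 2 * c := by
  have hb : 0 ≤ b := (norm_nonneg _).trans hs
  have hc : 0 ≤ c := (norm_nonneg _).trans hm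
  refine ContinuousLinearMap.opNorm_le_bound _ (by positivity) ?_
  rintro ⟨q, u, t⟩
  set N := ‖(q, u, t)‖ with hN
  have hq : |q| ≤ N := norm_fst_le (q, u, t)
  have hut : ‖(u, t)‖ ≤ N := norm_snd_le (q, u, t)
  have hu : ‖u‖ ≤ N := (norm_fst_le (u, t)).trans hut
  have ht : |t| ≤ N := (norm_snd_le (u, t)).trans hut
  have hN0 : 0 ≤ N := norm_nonneg _
  rw [demodulated_apply]
  have h1 : ‖q • m‖ ≤ N * c := by
    rw [norm_smul, Real.norm_eq_abs]; gcongr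
  have h2 : ‖inner ℝ s u • m‖ ≤ (b * N) * c := by
    rw [norm_smul]
    gcongr
    exact (norm_inner_le_norm _ _).trans (by gcongr)
  have h3 : ‖t • (1 / 2 * inner ℝ s (A s)) • m‖ ≤ N * ((‖A‖ * b ^ 2) * c) := by
    rw [norm_smul, norm_smul, Real.norm_eq_abs, Real.norm_eq_abs]
    gcongr
    rw [abs_mul]
    have := abs_inner_apply_self_le A s
    have h4 : ‖A‖ * ‖s‖ ^ 2 ≤ ‖A‖ * b ^ 2 := by gcongr
    have h5 : |(1 / 2 : ℝ)| = 1 / 2 := by norm_num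
    rw [h5]
    linarith [abs_nonneg (inner ℝ s (A s))]
  calc _ ≤ ‖q • m‖ + (‖inner ℝ s u • m‖ + ‖u‖) + ‖t • (1 / 2 * inner ℝ s (A s)) • m‖ :=
        norm_add₃_le.trans (by gcongr; exact norm_sub_le _ _)
    _ ≤ N * c + ((b * N) * c + N) + N * ((‖A‖ * b ^ 2) * c) := by gcongr
    _ = _ := by ring

/-- Dither and demodulation sequences of period `T` whose products have the averages required by
extremum seeking. -/
structure IsDither (A : E →L[ℝ] E) (T : ℕ) (S M : ℕ → E) : Prop where
  period_pos : 0 < T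
  periodic_dither : ∀ j, S (j + T) = S j
  periodic_demod : ∀ j, M (j + T) = M j
  sum_demod : ∑ j ∈ range T, M j = 0
  sum_inner_smul : ∀ u, ∑ j ∈ range T, inner ℝ (S j) u • M j = (T : ℝ) • u
  sum_quad_smul : ∑ j ∈ range T, inner ℝ (S j) (A (S j)) • M j = 0

/-- The sum of the oscillating part of the demodulated signal. -/
def oscSum (A : E →L[ℝ] E) (S M : ℕ → E) (j : ℕ) : ℝ × E × ℝ →L[ℝ] E :=
  ∑ i ∈ range j, demodulated A (S i) (M i)

/-- The averages in `IsDither` say exactly that `demodulated` sums to zero over a period: the term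
`-u` removes the mean of `⟨s, u⟩ m`, and the other terms have mean zero. -/
theorem IsDither.norm_oscSum_le {A : E →L[ℝ] E} {T : ℕ} {S M : ℕ → E} (h : IsDither A T S M)
    {b c : ℝ} (hS : ∀ j, ‖S j‖ ≤ b) (hM : ∀ j, ‖M j‖ ≤ c) (j : ℕ) :
    ‖oscSum A S M j‖ ≤ (c + (b * c + 1) + ‖A‖ * b ^ 2 * c) * T := by
  refine norm_sum_range_le_of_periodic (fun i => demodulated A (S i) (M i)) T h.period_pos _
    (fun i => norm_demodulated_le A _ _ (hS i) (hM i)) (fun i => ?_) ?_ j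
  · simp only [h.periodic_dither, h.periodic_demod]
  · refine ContinuousLinearMap.ext ?_
    rintro ⟨q, u, t⟩
    simp only [_root_.sum_apply, demodulated_apply, sum_add_distrib, sum_sub_distrib,
      ← smul_sum, h.sum_demod, h.sum_inner_smul, zero_apply, mul_smul,
      h.sum_quad_smul, sum_const, card_range, smul_zero, zero_add, add_zero]
    rw [Nat.cast_smul_eq_nsmul, sub_self]

/-- The slow features of the state on which the demodulated signal depends linearly. -/
def features (A : E →L[ℝ] E) (z : E) (w : ℝ) : ℝ × E × ℝ :=
  (1 / 2 * inner ℝ z (A z) - w, A z, 1)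

/-- Self-adjointness merges the cross terms of `⟨z + s, A (z + s)⟩` into one, linear in `A z`. Hence
the coefficients depend on the dither alone and can be summed over time independently of the state.
-/
theorem demodulated_features (A : E →L[ℝ] E) (hA : ∀ x y, inner ℝ (A x) y = inner ℝ x (A y))
    (s m z : E) (w : ℝ) :
    demodulated A s m (features A z w) =
      (1 / 2 * inner ℝ (z + s) (A (z + s)) - w) • m - A z := by
  rw [features, demodulated_apply, map_add, inner_add_left, inner_add_right, inner_add_right,
    ← hA z s, real_inner_comm s (A z)]
  module

theorem norm_features_le (A : E →L[ℝ] E) {z : E} {w R W : ℝ} (hz : ‖z‖ ≤ R) (hw : |w| ≤ W) :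
    ‖features A z w‖ ≤ ‖A‖ * R ^ 2 + W + ‖A‖ * R + 1 := by
  have hR : 0 ≤ R := (norm_nonneg _).trans hz
  have hW : 0 ≤ W := (abs_nonneg _).trans hw
  have h1 : ‖A z‖ ≤ ‖A‖ * R := (A.le_opNorm z).trans (by gcongr)
  have h2 : |inner ℝ z (A z)| ≤ ‖A‖ * R ^ 2 :=
    (abs_inner_apply_self_le A z).trans (by gcongr)
  have h3 : |1 / 2 * inner ℝ z (A z) - w| ≤ ‖A‖ * R ^ 2 + W := by
    rw [abs_le] at *
    constructor <;> nlinarith [mul_nonneg (norm_nonneg A) (sq_nonneg R)]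
  have h4 : 0 ≤ ‖A‖ * R := by positivity
  have h5 : 0 ≤ ‖A‖ * R ^ 2 := by positivity
  refine norm_prod_le_iff.2 ⟨?_, norm_prod_le_iff.2 ⟨?_, ?_⟩⟩
  · change |_| ≤ _; simp only [features]; linarith
  · simp only [features]; linarith
  · simp only [features, norm_one]; linarith

theorem norm_features_sub_le (A : E →L[ℝ] E) {z z' : E} {w w' R p q : ℝ} (hz : ‖z‖ ≤ R)
    (hz' : ‖z'‖ ≤ R) (hp : ‖z' - z‖ ≤ p) (hq : |w' - w| ≤ q) :
    ‖features A z' w' - features A z w‖ ≤ ‖A‖ * p * R + q + ‖A‖ * p := by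
  have hR : 0 ≤ R := (norm_nonneg _).trans hz
  have hp0 : 0 ≤ p := (norm_nonneg _).trans hp
  have hq0 : 0 ≤ q := (abs_nonneg _).trans hq
  have h1 : ‖A z' - A z‖ ≤ ‖A‖ * p := by
    rw [← map_sub]; exact (A.le_opNorm _).trans (by gcongr)
  have h2 : |inner ℝ z' (A z') - inner ℝ z (A z)| ≤ ‖A‖ * p * (R + R) :=
    (abs_inner_apply_self_sub_le A z' z).trans (by gcongr)
  have h3 : |1 / 2 * inner ℝ z' (A z') - w' - (1 / 2 * inner ℝ z (A z) - w)| ≤ ‖A‖ * p * R + q := by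
    rw [abs_le] at *
    constructor <;> linarith
  have h4 : 0 ≤ ‖A‖ * p := by positivity
  have h5 : 0 ≤ ‖A‖ * p * R := by positivity
  refine norm_prod_le_iff.2 ⟨?_, norm_prod_le_iff.2 ⟨?_, ?_⟩⟩
  · change |_| ≤ _; simp only [features, Prod.fst_sub]; linarith
  · simp only [features, Prod.fst_sub, Prod.snd_sub]; linarith
  · simp only [features, Prod.snd_sub, sub_self, norm_zero]; linarith

end Averaging

/-! ### The scaled recursion: one-step estimates and the cost of the delay. -/

noncomputable section NormalizedRun

open Finset

variable {E : Type*} [NormedAddCommGroup E] [InnerProductSpace ℝ E]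

/-- The extremum seeking recursion after scaling the estimation errors by powers of the decaying
gain; `x j` is the scaled argument of the quadratic map measured at time `j`. -/
structure IsNormalizedRun (A : E →L[ℝ] E) (k lam ωh ε : ℝ) (d₀ : ℕ) (S M z x : ℕ → E)
    (w : ℕ → ℝ) : Prop where
  estimate_step : ∀ j ≥ d₀, (1 - ε * lam) • z (j + 1) =
    z j - (ε * k * (1 / 2 * inner ℝ (x j) (A (x j)) - w j)) • M j
  filter_step : ∀ j ≥ d₀, (1 - ε * lam) ^ 2 * w (j + 1) =
    w j + ε * ωh * (1 / 2 * inner ℝ (x j) (A (x j)) - w j)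
  sample : ∀ j ≥ d₀, ∃ d ≤ d₀, (1 - ε * lam) ^ d • x j =
    z (j - d) + if j - d ≤ d₀ then 0 else S (j - d)

/-- After subtracting `(1 - ε lam) • z` every remaining term carries a factor `ε`; the constant 2
bounds `1 / (1 - ε lam)`. -/
theorem norm_estimate_increment_le {z z' m : E} {ε lam k e R e₀ c : ℝ} (hε : 0 ≤ ε)
    (hlam : 0 ≤ lam) (hk : 0 ≤ k) (hr : ε * lam ≤ 1 / 2)
    (h : (1 - ε * lam) • z' = z - (ε * k * e) • m) (hz : ‖z‖ ≤ R) (he : |e| ≤ e₀)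
    (hm : ‖m‖ ≤ c) : ‖z' - z‖ ≤ ε * (2 * (lam * R + k * e₀ * c)) := by
  have he₀ : 0 ≤ e₀ := (abs_nonneg _).trans he
  have h1 : (1 - ε * lam) • (z' - z) = (ε * lam) • z - (ε * k * e) • m := by
    rw [smul_sub, h]; module
  have h2 : (1 - ε * lam) * ‖z' - z‖ ≤ ε * lam * R + ε * k * e₀ * c := by
    calc (1 - ε * lam) * ‖z' - z‖ = ‖(1 - ε * lam) • (z' - z)‖ := by
          rw [norm_smul, Real.norm_of_nonneg (by linarith)]
      _ ≤ ‖(ε * lam) • z‖ + ‖(ε * k * e) • m‖ := by rw [h1]; exact norm_sub_le _ _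
      _ = ε * lam * ‖z‖ + ε * k * |e| * ‖m‖ := by
          rw [norm_smul, norm_smul, Real.norm_of_nonneg (by positivity), norm_mul,
            Real.norm_of_nonneg (by positivity), Real.norm_eq_abs]
      _ ≤ _ := by gcongr
  nlinarith [mul_nonneg (sub_nonneg.2 hr) (norm_nonneg (z' - z))]

theorem abs_filter_increment_le {w w' ε lam ωh e W e₀ : ℝ} (hε : 0 ≤ ε)
    (hlam : 0 ≤ lam) (hωh : 0 ≤ ωh) (hr : ε * lam ≤ 1 / 2)
    (h : (1 - ε * lam) ^ 2 * w' = w + ε * ωh * e) (hw : |w| ≤ W) (he : |e| ≤ e₀) :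
    |w' - w| ≤ ε * (4 * (2 * lam * W + ωh * e₀)) := by
  have hl : 0 ≤ ε * lam := by positivity
  have h1 : (1 - ε * lam) ^ 2 * (w' - w) = (ε * lam * (2 - ε * lam)) * w + ε * ωh * e := by
    linear_combination h
  have h2 : (1 - ε * lam) ^ 2 * |w' - w| ≤ (2 * (ε * lam)) * W + ε * ωh * e₀ := by
    calc (1 - ε * lam) ^ 2 * |w' - w| = |(1 - ε * lam) ^ 2 * (w' - w)| := by
          rw [abs_mul, abs_of_nonneg (sq_nonneg (1 - ε * lam))]
      _ ≤ |(ε * lam * (2 - ε * lam)) * w| + |ε * ωh * e| := by rw [h1]; exact abs_add_le _ _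
      _ = (ε * lam * (2 - ε * lam)) * |w| + ε * ωh * |e| := by
          rw [abs_mul, abs_mul (ε * ωh), abs_of_nonneg (mul_nonneg hl (by linarith)),
            abs_of_nonneg (by positivity : 0 ≤ ε * ωh)]
      _ ≤ (2 * (ε * lam)) * W + ε * ωh * e₀ := by
          have h3 : 0 ≤ ε * lam * (2 - ε * lam) := mul_nonneg hl (by linarith)
          have h4 : ε * lam * (2 - ε * lam) ≤ 2 * (ε * lam) := by nlinarith
          gcongr
  have h3 : 1 / 4 ≤ (1 - ε * lam) ^ 2 := by nlinarith
  nlinarith [mul_nonneg (sub_nonneg.2 h3) (abs_nonneg (w' - w))]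

/-- Scaling by `α²` amplifies `w` at rate `2 ε lam` to first order, while the filter damps it at
rate `ε ωh`. The surplus `ωh - 2 lam` has to absorb the forcing `ωh Y`. -/
theorem abs_filter_le {w w' ε lam ωh y W Y : ℝ} (hε : 0 ≤ ε) (hωh : 0 ≤ ωh)
    (hr : ε * lam ≤ 1 / 2) (hωε : ε * ωh ≤ 1)
    (h : (1 - ε * lam) ^ 2 * w' = w + ε * ωh * (y - w)) (hw : |w| ≤ W) (hy : |y| ≤ Y)
    (hW : ωh * Y ≤ (ωh - 2 * lam) * W) : |w'| ≤ W := by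
  have hW0 : 0 ≤ W := (abs_nonneg _).trans hw
  have h2 : (1 - ε * lam) ^ 2 * |w'| ≤ (1 - ε * ωh) * W + ε * ωh * Y := by
    calc (1 - ε * lam) ^ 2 * |w'| = |(1 - ε * ωh) * w + ε * ωh * y| := by
          rw [← abs_of_nonneg (mul_nonneg (sq_nonneg (1 - ε * lam)) (abs_nonneg w')), abs_mul,
            abs_abs, ← abs_mul, h]
          congr 1; ring
      _ ≤ |(1 - ε * ωh) * w| + |ε * ωh * y| := abs_add_le _ _
      _ = (1 - ε * ωh) * |w| + ε * ωh * |y| := by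
          rw [abs_mul, abs_mul (ε * ωh), abs_of_nonneg (by linarith : 0 ≤ 1 - ε * ωh),
            abs_of_nonneg (by positivity : 0 ≤ ε * ωh)]
      _ ≤ _ := by gcongr
  have h3 : (1 - ε * ωh) * W + ε * ωh * Y ≤ (1 - ε * lam) ^ 2 * W := by
    nlinarith [mul_le_mul_of_nonneg_left hW hε, mul_nonneg (sq_nonneg (ε * lam)) hW0]
  have h4 : 0 < (1 - ε * lam) ^ 2 := by nlinarith
  exact le_of_mul_le_mul_left (h2.trans h3) h4

theorem norm_sample_le {x z s : E} {ρ R b : ℝ} (hρ : 1 / 2 ≤ ρ) (h : ρ • x = z + s)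
    (hz : ‖z‖ ≤ R) (hs : ‖s‖ ≤ b) : ‖x‖ ≤ 2 * (R + b) := by
  have h1 : ρ * ‖x‖ ≤ R + b := by
    calc ρ * ‖x‖ = ‖ρ • x‖ := by rw [norm_smul, Real.norm_of_nonneg (by linarith)]
      _ ≤ ‖z‖ + ‖s‖ := by rw [h]; exact norm_add_le _ _
      _ ≤ _ := by gcongr
  nlinarith [mul_nonneg (sub_nonneg.2 hρ) (norm_nonneg x)]

theorem norm_sub_le_of_increments {V : Type*} [SeminormedAddCommGroup V] (f : ℕ → V) {p : ℝ}
    {m j d d₀ : ℕ} (hp : 0 ≤ p) (hd : d ≤ d₀) (hj : m + d ≤ j)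
    (h : ∀ i, m ≤ i → i < j → ‖f (i + 1) - f i‖ ≤ p) : ‖f (j - d) - f j‖ ≤ d₀ * p := by
  rw [← dist_eq_norm]
  calc dist (f (j - d)) (f j) ≤ ∑ i ∈ Ico (j - d) j, p :=
        dist_le_Ico_sum_of_dist_le (by omega) fun {i} hi hi' => by
          rw [dist_comm, dist_eq_norm]; exact h i (by omega) hi'
    _ = d * p := by simp [Nat.sub_sub_self (show d ≤ j by omega)]
    _ ≤ _ := by gcongr

/-- One step of the averaged coordinate `z + εk Φ ξ`. -/
theorem norm_averaged_step_le (A K : E →L[ℝ] E)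
    (hA : ∀ x y, inner ℝ (A x) y = inner ℝ x (A y))
    {ε lam k : ℝ} (hK : K = k • A - lam • ContinuousLinearMap.id ℝ E) (hε : 0 ≤ ε)
    (hlam : 0 ≤ lam) (hk : 0 ≤ k) {γ : ℝ}
    (hγ : ∀ x, ‖x - ε • K x‖ ≤ (1 - ε * γ) * ‖x‖) {Φ : ℝ × E × ℝ →L[ℝ] E}
    {z z' x s m : E} {w w' B Ξ p q e c : ℝ}
    (h : (1 - ε * lam) • z' = z - (ε * k * (1 / 2 * inner ℝ x (A x) - w)) • m)
    (hΦ : ‖Φ‖ ≤ B) (hΦ' : ‖Φ + demodulated A s m‖ ≤ B) (hΞ : ‖features A z w‖ ≤ Ξ)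
    (hp : ‖z' - z‖ ≤ p) (hq : ‖features A z' w' - features A z w‖ ≤ q)
    (he : |1 / 2 * inner ℝ x (A x) - 1 / 2 * inner ℝ (z + s) (A (z + s))| ≤ e) (hm : ‖m‖ ≤ c) :
    ‖z' + (ε * k) • (Φ + demodulated A s m) (features A z' w')‖ ≤
      (1 - ε * γ) * ‖z + (ε * k) • Φ (features A z w)‖ +
        ε * (ε * k * (‖K‖ * (B * Ξ)) + lam * p + k * (B * q) + k * e * c) := by
  have hB : 0 ≤ B := (norm_nonneg Φ).trans hΦ
  have hee : 0 ≤ e := (abs_nonneg _).trans he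
  set ξ := features A z w with hξ
  set ξ' := features A z' w' with hξ'
  set er := 1 / 2 * inner ℝ x (A x) - 1 / 2 * inner ℝ (z + s) (A (z + s)) with her
  have hdem := demodulated_features A hA s m z w
  set v := z + (ε * k) • Φ ξ with hv
  -- By `demodulated_features` the new summand of `Φ` cancels the oscillation in `z'` and leaves
  -- `-εk A z`. With `ε lam z` this is `-ε K z`; replacing `z` by `v` there costs `ε (εk) K (Φ ξ)`.
  have key : z' + (ε * k) • (Φ + demodulated A s m) ξ' =
      (v - ε • K v) + ε • ((ε * k) • K (Φ ξ) + lam • (z' - z) +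
        k • (Φ + demodulated A s m) (ξ' - ξ) - (k * er) • m) := by
    have hz' : z' = z - (ε * k * (1 / 2 * inner ℝ x (A x) - w)) • m + (ε * lam) • z' := by
      rw [← h]; module
    have hKv : K v = K z + (ε * k) • K (Φ ξ) := by rw [hv, map_add, map_smul]
    have hKz : K z = k • A z - lam • z := by simp [hK]
    rw [hKv, hKz, map_sub, add_apply, add_apply, hdem, hv]
    rw [← sub_eq_zero] at hz' ⊢
    rw [← hz', her]
    module
  rw [key]
  refine (norm_add_le _ _).trans (add_le_add (hγ v) ?_)
  rw [norm_smul, Real.norm_of_nonneg hε]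
  refine mul_le_mul_of_nonneg_left ?_ hε
  refine (norm_sub_le _ _).trans (add_le_add (norm_add₃_le.trans (add_le_add_three ?_ ?_ ?_)) ?_)
  · rw [norm_smul, Real.norm_of_nonneg (by positivity)]
    gcongr
    refine (K.le_opNorm _).trans ?_
    gcongr
    exact (Φ.le_opNorm _).trans (by gcongr)
  · rw [norm_smul, Real.norm_of_nonneg hlam]; gcongr
  · rw [norm_smul, Real.norm_of_nonneg hk]
    gcongr
    exact (ContinuousLinearMap.le_opNorm _ _).trans (by gcongr)
  · rw [norm_smul, norm_mul, Real.norm_of_nonneg hk, Real.norm_eq_abs]; gcongr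

/-- A run all of whose states up to time `j` are bounded by `R` and `W`. -/
structure BoundedUpTo (d₀ : ℕ) (z : ℕ → E) (w : ℕ → ℝ) (R W : ℝ) (j : ℕ) : Prop where
  estimate : ∀ i ≤ j, ‖z i‖ ≤ R
  filter : ∀ i, d₀ ≤ i → i ≤ j → |w i| ≤ W

section Steps

variable {A : E →L[ℝ] E} {k lam ωh ε : ℝ} {d₀ : ℕ} {S M z x : ℕ → E} {w : ℕ → ℝ}
  {R W b c X Y : ℝ}

theorem one_sub_mul_pow_bounds {t : ℝ} (ht : 0 ≤ t) {d d₀ : ℕ} (hd : d ≤ d₀)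
    (hr : t ≤ 1 / 2) (hd₀ : d₀ * t ≤ 1 / 2) :
    1 / 2 ≤ (1 - t) ^ d ∧ 1 - (1 - t) ^ d ≤ d₀ * t ∧ (1 - t) ^ d ≤ 1 := by
  have h := one_add_mul_le_pow (a := -t) (by linarith) d
  have h1 : (d : ℝ) * t ≤ d₀ * t := by gcongr
  rw [← sub_eq_add_neg] at h
  exact ⟨by linarith, by linarith, pow_le_one₀ (by linarith) (by linarith)⟩

theorem IsNormalizedRun.norm_sample_le (h : IsNormalizedRun A k lam ωh ε d₀ S M z x w)
    (hεl : 0 ≤ ε * lam) (hr : ε * lam ≤ 1 / 2) (hd : d₀ * (ε * lam) ≤ 1 / 2)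
    (hS : ∀ j, ‖S j‖ ≤ b) {j : ℕ} (hB : BoundedUpTo d₀ z w R W j) (hj : d₀ ≤ j) :
    ‖x j‖ ≤ 2 * (R + b) := by
  obtain ⟨d, hd', hx⟩ := h.sample j hj
  refine _root_.norm_sample_le (one_sub_mul_pow_bounds hεl hd' hr hd).1 hx
    (hB.estimate _ (Nat.sub_le _ _)) ?_
  split_ifs
  · simpa using (norm_nonneg _).trans (hS 0)
  · exact hS _

/-- The delay costs only what changes in at most `d₀` steps: the gain factor, the estimate (`p` per
step) and the dither (`δ` per step). The condition `2 * d₀ < j` ensures `j - d > d₀`, so the sampled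
input was already dithered and the increment bounds apply. -/
theorem IsNormalizedRun.abs_error_le (h : IsNormalizedRun A k lam ωh ε d₀ S M z x w)
    (hεl : 0 ≤ ε * lam) (hr : ε * lam ≤ 1 / 2) (hd : d₀ * (ε * lam) ≤ 1 / 2)
    (hS : ∀ j, ‖S j‖ ≤ b) (hX : X = 2 * (R + b)) {p δ : ℝ} (hp : 0 ≤ p)
    (hSδ : ∀ j, ‖S (j + 1) - S j‖ ≤ δ) {j : ℕ} (hB : BoundedUpTo d₀ z w R W j)
    (hj : 2 * d₀ < j) (hz : ∀ i, d₀ ≤ i → i < j → ‖z (i + 1) - z i‖ ≤ p) :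
    |1 / 2 * inner ℝ (x j) (A (x j)) - 1 / 2 * inner ℝ (z j + S j) (A (z j + S j))| ≤
      ‖A‖ * X * (d₀ * (ε * lam * X + p + δ)) := by
  have hδ : 0 ≤ δ := (norm_nonneg _).trans (hSδ 0)
  have hx := h.norm_sample_le hεl hr hd hS hB (by omega : d₀ ≤ j)
  rw [← hX] at hx
  have hX0 : 0 ≤ X := (norm_nonneg _).trans hx
  obtain ⟨d, hd', hxe⟩ := h.sample j (by omega)
  rw [if_neg (by omega)] at hxe
  obtain ⟨-, hpow, hpow1⟩ := one_sub_mul_pow_bounds hεl hd' hr hd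
  have hzs : ‖z j + S j‖ ≤ X := by
    have := norm_add_le (z j) (S j)
    linarith [hB.estimate j le_rfl, hS j, norm_nonneg (z j + S j)]
  have hdiff : ‖x j - (z j + S j)‖ ≤ d₀ * (ε * lam * X + p + δ) := by
    have e1 : x j - (z j + S j) =
        (1 - (1 - ε * lam) ^ d) • x j + (z (j - d) - z j) + (S (j - d) - S j) := by
      rw [sub_smul, one_smul, hxe]; abel
    have h1 : ‖(1 - (1 - ε * lam) ^ d) • x j‖ ≤ d₀ * (ε * lam) * X := by
      rw [norm_smul, Real.norm_of_nonneg (by linarith)]; gcongr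
    have h2 := norm_sub_le_of_increments z hp hd' (m := d₀) (j := j) (by omega) hz
    have h3 := norm_sub_le_of_increments S hδ hd' (m := 0) (j := j) (by omega)
      fun i _ _ => hSδ i
    rw [e1]
    refine norm_add₃_le.trans ?_
    linarith
  have h1 := abs_inner_apply_self_sub_le A (x j) (z j + S j)
  have h2 : ‖A‖ * ‖x j - (z j + S j)‖ * (‖x j‖ + ‖z j + S j‖) ≤
      ‖A‖ * (d₀ * (ε * lam * X + p + δ)) * (X + X) := by gcongr
  rw [← mul_sub, abs_mul, abs_of_pos (by norm_num : (0 : ℝ) < 1 / 2)]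
  linarith

end Steps

end NormalizedRun

/-! ### Boundedness of the scaled recursion by induction on time. -/

noncomputable section NormalizedBound

open Finset

variable {E : Type*} [NormedAddCommGroup E] [InnerProductSpace ℝ E]

/-- Boundedness of normalized runs, under explicit smallness conditions on the parameter `δ` that
dominates `ε`, `ε T` and the increments of the dither. -/
theorem IsNormalizedRun.boundedUpTo {A K : E →L[ℝ] E} {k lam ωh ε δ γ : ℝ} {d₀ T : ℕ}
    {S M z x : ℕ → E} {w : ℕ → ℝ} (h : IsNormalizedRun A k lam ωh ε d₀ S M z x w)
    (hA : ∀ x y, inner ℝ (A x) y = inner ℝ x (A y))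
    (hK : K = k • A - lam • ContinuousLinearMap.id ℝ E)
    (hγ : ∀ x, 2 * γ * ‖x‖ ^ 2 ≤ inner ℝ x (K x)) (hγ0 : 0 < γ)
    (hk : 0 ≤ k) (hlam : 0 ≤ lam) (hωh : 0 ≤ ωh)
    (hSM : IsDither A T S M)
    {R W b c X Y ρ₀ e₀ p q Ξ G e : ℝ}
    (hS : ∀ j, ‖S j‖ ≤ b) (hM : ∀ j, ‖M j‖ ≤ c) (hSδ : ∀ j, ‖S (j + 1) - S j‖ ≤ δ)
    (hz₀ : ∀ j ≤ d₀, ‖z j‖ ≤ ρ₀) (hw₀ : |w d₀| ≤ W)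
    (hR : R = ρ₀ + 3) (hX : X = 2 * (R + b)) (hY : Y = ‖A‖ * X ^ 2)
    (hW : ωh * Y ≤ (ωh - 2 * lam) * W) (he₀ : e₀ = Y + W)
    (hp : p = 2 * (lam * R + k * e₀ * c))
    (hq : q = ‖A‖ * p * (R + 1) + 4 * (2 * lam * W + ωh * e₀) + ‖A‖ * p)
    (hΞ : Ξ = ‖A‖ * (R + 1) ^ 2 + W + ‖A‖ * (R + 1) + 1)
    (hG : G = c + (b * c + 1) + ‖A‖ * b ^ 2 * c)
    (he : e = ‖A‖ * X * (d₀ * (lam * X + p + 1)))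
    (hε : 0 < ε) (hεδ : ε ≤ δ) (hεT : ε * T ≤ δ)
    (s1 : δ * lam ≤ 1 / 2) (s2 : d₀ * (δ * lam) ≤ 1 / 2) (s3 : δ * ωh ≤ 1) (s4 : δ * p ≤ 1)
    (s5 : δ * ‖K‖ ^ 2 ≤ 2 * γ) (s6 : δ * γ ≤ 1)
    (s7 : δ * (k * (G * Ξ)) ≤ 1 / 2)
    (s8 : δ * (k * (‖K‖ * (G * Ξ)) + lam * p + k * (G * q) + k * e * c) ≤ γ * (ρ₀ + 1))
    (s9 : δ * ((2 * d₀ + 1) * (k * (2 * Y) * c)) ≤ 1)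
    (j : ℕ) (hj : d₀ ≤ j) : BoundedUpTo d₀ z w R W j := by
  have hρ₀ : 0 ≤ ρ₀ := (norm_nonneg _).trans (hz₀ 0 (Nat.zero_le _))
  have hb : 0 ≤ b := (norm_nonneg _).trans (hS 0)
  have hc : 0 ≤ c := (norm_nonneg _).trans (hM 0)
  have hW0 : 0 ≤ W := (abs_nonneg _).trans hw₀
  have hR0 : 0 ≤ R := by linarith
  have hX0 : 0 ≤ X := by rw [hX]; positivity
  have hY0 : 0 ≤ Y := by rw [hY]; positivity
  have he₀0 : 0 ≤ e₀ := by linarith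
  have hp0 : 0 ≤ p := by rw [hp]; positivity
  have hq0 : 0 ≤ q := by rw [hq]; positivity
  have hΞ0 : 0 ≤ Ξ := by rw [hΞ]; positivity
  have hG0 : 0 ≤ G := by rw [hG]; positivity
  have hee0 : 0 ≤ e := by rw [he]; positivity
  have hδ : 0 < δ := hε.trans_le hεδ
  have hεl : 0 ≤ ε * lam := by positivity
  have t1 : ε * lam ≤ 1 / 2 := le_trans (by gcongr) s1
  have t2 : d₀ * (ε * lam) ≤ 1 / 2 := le_trans (by gcongr) s2
  have t3 : ε * ωh ≤ 1 := le_trans (by gcongr) s3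
  have t4 : ε * p ≤ 1 := le_trans (by gcongr) s4
  have t5 : ε * ‖K‖ ^ 2 ≤ 2 * γ := le_trans (by gcongr) s5
  have t6 : ε * γ ≤ 1 := le_trans (by gcongr) s6
  have hcontr := norm_sub_smul_apply_le K hγ hε.le t5 t6
  set Φ := oscSum A S M with hΦ
  have hΦT : ∀ j, ‖Φ j‖ ≤ G * T := fun j => hG ▸ hSM.norm_oscSum_le hS hM j
  have hΦs : ∀ j, Φ (j + 1) = Φ j + demodulated A (S j) (M j) := fun j => sum_range_succ _ _
  have hεΦ : ∀ (j : ℕ) (ξ : ℝ × E × ℝ) (N : ℝ), ‖ξ‖ ≤ N →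
      ‖(ε * k) • Φ j ξ‖ ≤ δ * (k * (G * N)) := by
    intro j ξ N hN
    have hN0 : 0 ≤ N := (norm_nonneg _).trans hN
    have h1 : ‖Φ j ξ‖ ≤ G * T * N := ((Φ j).le_opNorm ξ).trans (by gcongr; exact hΦT j)
    rw [norm_smul, Real.norm_of_nonneg (by positivity)]
    calc ε * k * ‖Φ j ξ‖ ≤ ε * k * (G * T * N) := by gcongr
      _ = (ε * T) * (k * (G * N)) := by ring
      _ ≤ _ := by gcongr
  have hquad : ∀ u : E, ‖u‖ ≤ X → |1 / 2 * inner ℝ u (A u)| ≤ Y := by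
    intro u hu
    have h1 := abs_inner_apply_self_le A u
    have h2 : ‖A‖ * ‖u‖ ^ 2 ≤ Y := by rw [hY]; gcongr
    rw [abs_mul, abs_of_pos (by norm_num : (0 : ℝ) < 1 / 2)]
    linarith [abs_nonneg (inner ℝ u (A u))]
  set v : ℕ → E := fun j => z j + (ε * k) • Φ j (features A (z j) (w j)) with hv
  have hfeat : ∀ j, ‖z j‖ ≤ R + 1 → |w j| ≤ W → ‖features A (z j) (w j)‖ ≤ Ξ :=
    fun j hz hw => hΞ ▸ norm_features_le A hz hw
  set C := k * (2 * Y) * c with hC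
  have hC0 : 0 ≤ C := by positivity
  have hinc : ∀ i j, BoundedUpTo d₀ z w R W j → d₀ ≤ i → i ≤ j →
      ‖z (i + 1) - z i‖ ≤ ε * p := by
    intro i j hB hi hij
    have hBi : BoundedUpTo d₀ z w R W i :=
      ⟨fun l hl => hB.estimate l (hl.trans hij), fun l hl hl' => hB.filter l hl (hl'.trans hij)⟩
    have hx := h.norm_sample_le hεl t1 t2 hS hBi hi
    rw [← hX] at hx
    rw [hp]
    refine norm_estimate_increment_le hε.le hlam hk t1 (h.estimate_step i hi)
      (hBi.estimate i le_rfl) ?_ (hM i)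
    rw [he₀]
    exact (abs_sub _ _).trans (add_le_add (hquad _ hx) (hBi.filter i hi le_rfl))
  -- Up to time `2 * d₀` a sample may predate the dither, and the output error is only bounded by `2
  -- * Y`. The term with `min` pays for these finitely many steps, at most `ε * C` each; `s9` keeps
  -- the total below 1.
  have main : ∀ j, d₀ ≤ j → BoundedUpTo d₀ z w R W j ∧
      ‖v j‖ ≤ ρ₀ + 1 + ε * C * (min j (2 * d₀ + 1) : ℕ) := by
    intro j hj
    induction j, hj using Nat.le_induction with
    | base =>
      refine ⟨⟨fun i hi => (hz₀ i hi).trans (by linarith), fun i hi hi' => ?_⟩, ?_⟩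
      · rw [le_antisymm hi' hi]; exact hw₀
      · have h1 := hεΦ d₀ _ Ξ (hfeat d₀ ((hz₀ d₀ le_rfl).trans (by linarith)) hw₀)
        have h2 : 0 ≤ ε * C * (min d₀ (2 * d₀ + 1) : ℕ) := by positivity
        calc ‖v d₀‖ ≤ ‖z d₀‖ + _ := norm_add_le _ _
          _ ≤ ρ₀ + δ * (k * (G * Ξ)) := add_le_add (hz₀ d₀ le_rfl) h1
          _ ≤ _ := by linarith
    | succ j hj ih =>
      obtain ⟨hB, hvj⟩ := ih
      have hx := h.norm_sample_le hεl t1 t2 hS hB hj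
      rw [← hX] at hx
      have hxY := hquad _ hx
      have hzj := hB.estimate j le_rfl
      have hwj := hB.filter j hj le_rfl
      have hdz := hinc j j hB hj le_rfl
      -- A crude bound, enough to control the features at `j + 1`; the averaged coordinate then
      -- restores the bound `R`.
      have hz1 : ‖z (j + 1)‖ ≤ R + 1 := by
        have := norm_le_norm_add_norm_sub' (z (j + 1)) (z j)
        linarith
      have hw1 : |w (j + 1)| ≤ W :=
        abs_filter_le hε.le hωh t1 t3 (h.filter_step j hj) hwj hxY hW
      have hdw := abs_filter_increment_le hε.le hlam hωh t1 (h.filter_step j hj) hwj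
        (he₀ ▸ (abs_sub _ _).trans (add_le_add hxY hwj))
      have hdξ : ‖features A (z (j + 1)) (w (j + 1)) - features A (z j) (w j)‖ ≤ ε * q := by
        refine (norm_features_sub_le A (hzj.trans (by linarith)) hz1 hdz hdw).trans (le_of_eq ?_)
        rw [hq]; ring
      have hξ := hfeat j (hzj.trans (by linarith)) hwj
      have hzs : ‖z j + S j‖ ≤ X := by
        have := norm_add_le (z j) (S j)
        linarith [hS j, norm_nonneg (z j + S j)]
      have herr : |1 / 2 * inner ℝ (x j) (A (x j)) - 1 / 2 * inner ℝ (z j + S j) (A (z j + S j))| ≤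
          δ * e + if j ≤ 2 * d₀ then 2 * Y else 0 := by
        split_ifs with hjd
        · have := (abs_sub _ _).trans (add_le_add hxY (hquad _ hzs))
          have : 0 ≤ δ * e := by positivity
          linarith
        · rw [add_zero]
          refine (h.abs_error_le hεl t1 t2 hS hX (by positivity : 0 ≤ ε * p) hSδ hB
            (not_le.1 hjd) fun i hi hij => hinc i j hB hi hij.le).trans ?_
          rw [he]
          have : ε * lam * X + ε * p + δ ≤ δ * (lam * X + p + 1) := by
            have h1 : ε * (lam * X) ≤ δ * (lam * X) := by gcongr
            have h2 : ε * p ≤ δ * p := by gcongr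
            linarith
          calc _ ≤ ‖A‖ * X * (d₀ * (δ * (lam * X + p + 1))) := by gcongr
            _ = _ := by ring
      have hstep := norm_averaged_step_le A K hA hK hε.le hlam hk hcontr
        (h.estimate_step j hj) (hΦT j) (hΦs j ▸ hΦT (j + 1)) hξ hdz hdξ herr (hM j)
      rw [← hΦs j] at hstep
      change ‖v (j + 1)‖ ≤ (1 - ε * γ) * ‖v j‖ + _ at hstep
      have hv1 : ‖v (j + 1)‖ ≤ ρ₀ + 1 + ε * C * (min (j + 1) (2 * d₀ + 1) : ℕ) := by
        have r1 : ε * k * (‖K‖ * (G * T * Ξ)) ≤ δ * (k * (‖K‖ * (G * Ξ))) := by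
          calc _ = (ε * T) * (k * (‖K‖ * (G * Ξ))) := by ring
            _ ≤ _ := by gcongr
        have r2 : lam * (ε * p) ≤ δ * (lam * p) := by
          calc _ = ε * (lam * p) := by ring
            _ ≤ _ := by gcongr
        have r3 : k * (G * T * (ε * q)) ≤ δ * (k * (G * q)) := by
          calc _ = (ε * T) * (k * (G * q)) := by ring
            _ ≤ _ := by gcongr
        set m : ℝ := ((min j (2 * d₀ + 1) : ℕ) : ℝ) with hm
        set I : ℝ := if j ≤ 2 * d₀ then 1 else 0 with hI
        have hm1 : ((min (j + 1) (2 * d₀ + 1) : ℕ) : ℝ) = m + I := by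
          rw [hm, hI]
          split_ifs with hjd
          · rw [min_eq_left (by omega), min_eq_left (by omega)]; push_cast; ring
          · rw [min_eq_right (by omega), min_eq_right (by omega)]; ring
        have r4 : k * (δ * e + if j ≤ 2 * d₀ then 2 * Y else 0) * c = δ * (k * e * c) + C * I := by
          rw [hI, hC]; split_ifs <;> ring
        have hm0 : 0 ≤ m := Nat.cast_nonneg _
        rw [r4] at hstep
        -- By `s8` the lasting errors do not exceed `γ (ρ₀ + 1)`, which is what the contraction
        -- gains at the level `ρ₀ + 1`.
        have r5 : ε * (ε * k * (‖K‖ * (G * T * Ξ)) + lam * (ε * p) + k * (G * T * (ε * q)) +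
            (δ * (k * e * c) + C * I)) ≤ ε * (γ * (ρ₀ + 1) + C * I) :=
          mul_le_mul_of_nonneg_left (by linarith) hε.le
        have r6 : (1 - ε * γ) * ‖v j‖ ≤ (1 - ε * γ) * (ρ₀ + 1 + ε * C * m) := by
          gcongr
        have r7 : 0 ≤ ε * γ * (ε * C * m) := by positivity
        rw [hm1]
        linarith
      refine ⟨⟨fun i hi => ?_, fun i hi hi' => ?_⟩, hv1⟩
      · rcases hi.lt_or_eq with hlt | rfl
        · exact hB.estimate i (by omega)
        -- Here `‖v‖ ≤ ρ₀ + 2` and the averaging correction is at most `1 / 2`, within `R = ρ₀ + 3`.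
        · have h1 := hεΦ (j + 1) _ Ξ (hfeat (j + 1) hz1 hw1)
          have h2 : ε * C * (min (j + 1) (2 * d₀ + 1) : ℕ) ≤ 1 := by
            have h3 : ((min (j + 1) (2 * d₀ + 1) : ℕ) : ℝ) ≤ 2 * d₀ + 1 := by
              exact_mod_cast min_le_right _ _
            calc _ ≤ δ * C * (2 * d₀ + 1) := by gcongr
              _ = δ * ((2 * d₀ + 1) * C) := by ring
              _ ≤ 1 := s9
          have h3 : z (j + 1) = v (j + 1) -
              (ε * k) • Φ (j + 1) (features A (z (j + 1)) (w (j + 1))) := by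
            simp [hv]
          rw [h3]
          have := norm_sub_le (v (j + 1)) ((ε * k) • Φ (j + 1) (features A (z (j + 1)) (w (j + 1))))
          linarith
      · rcases hi'.lt_or_eq with hlt | rfl
        · exact hB.filter i hi (by omega)
        · exact hw1
  exact (main j hj).1

theorem eventually_mul_le (C : ℝ) {B : ℝ} (hB : 0 < B) : ∀ᶠ δ : ℝ in 𝓝[>] 0, δ * C ≤ B := by
  have h : Tendsto (fun δ : ℝ => δ * C) (𝓝[>] 0) (𝓝 0) := by
    have : Tendsto (fun δ : ℝ => δ * C) (𝓝 0) (𝓝 (0 * C)) := (continuous_mul_const C).tendsto 0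
    rw [zero_mul] at this
    exact this.mono_left nhdsWithin_le_nhds
  exact (h.eventually (gt_mem_nhds hB)).mono fun _ => le_of_lt

/-- Uniform boundedness of normalized runs for slow adaptation and slow dither. -/
theorem exists_bounds_of_isNormalizedRun (A : E →L[ℝ] E)
    (hA : ∀ x y, inner ℝ (A x) y = inner ℝ x (A y)) {k lam ωh γ : ℝ} (hγ0 : 0 < γ)
    (hγ : ∀ x, 2 * γ * ‖x‖ ^ 2 ≤ inner ℝ x (k • A x - lam • x))
    (hk : 0 ≤ k) (hlam : 0 ≤ lam) (hωlam : 2 * lam < ωh) (d₀ : ℕ) {b c ρ₀ W₀ : ℝ}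
    (hρ₀ : 0 ≤ ρ₀) (hW₀ : 0 ≤ W₀) :
    ∃ δ > 0, ∃ R > 0, ∃ W > 0, ∀ (ε : ℝ) (T : ℕ) (S M z x : ℕ → E) (w : ℕ → ℝ),
      0 < ε → ε ≤ δ → ε * T ≤ δ → (∀ j, ‖S (j + 1) - S j‖ ≤ δ) →
      (∀ j, ‖S j‖ ≤ b) → (∀ j, ‖M j‖ ≤ c) → IsDither A T S M →
      IsNormalizedRun A k lam ωh ε d₀ S M z x w →
      (∀ j ≤ d₀, ‖z j‖ ≤ ρ₀) → |w d₀| ≤ W₀ → ∀ j ≥ d₀, ‖z j‖ < R ∧ |w j| < W := by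
  -- No circularity: `R` depends only on `ρ₀`, then `X` and `Y` on `R`, `W` on `Y`, and the
  -- remaining constants on these; `δ` is chosen last.
  obtain ⟨K, hK⟩ : ∃ K, K = k • A - lam • ContinuousLinearMap.id ℝ E := ⟨_, rfl⟩
  obtain ⟨R, hR⟩ : ∃ R, R = ρ₀ + 3 := ⟨_, rfl⟩
  obtain ⟨X, hX⟩ : ∃ X, X = 2 * (R + b) := ⟨_, rfl⟩
  obtain ⟨Y, hY⟩ : ∃ Y, Y = ‖A‖ * X ^ 2 := ⟨_, rfl⟩
  obtain ⟨W, hWdef⟩ : ∃ W, W = W₀ + ωh * Y / (ωh - 2 * lam) := ⟨_, rfl⟩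
  obtain ⟨e₀, he₀⟩ : ∃ e₀, e₀ = Y + W := ⟨_, rfl⟩
  obtain ⟨p, hp⟩ : ∃ p, p = 2 * (lam * R + k * e₀ * c) := ⟨_, rfl⟩
  obtain ⟨q, hq⟩ : ∃ q, q = ‖A‖ * p * (R + 1) + 4 * (2 * lam * W + ωh * e₀) + ‖A‖ * p := ⟨_, rfl⟩
  obtain ⟨Ξ, hΞ⟩ : ∃ Ξ, Ξ = ‖A‖ * (R + 1) ^ 2 + W + ‖A‖ * (R + 1) + 1 := ⟨_, rfl⟩
  obtain ⟨G, hG⟩ : ∃ G, G = c + (b * c + 1) + ‖A‖ * b ^ 2 * c := ⟨_, rfl⟩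
  obtain ⟨e, he⟩ : ∃ e, e = ‖A‖ * X * (d₀ * (lam * X + p + 1)) := ⟨_, rfl⟩
  have hωh : 0 ≤ ωh := by linarith
  have hgap : 0 < ωh - 2 * lam := by linarith
  have hY0 : 0 ≤ Y := by rw [hY]; positivity
  have hWW : W₀ ≤ W := by
    have : 0 ≤ ωh * Y / (ωh - 2 * lam) := by positivity
    linarith
  have hW : ωh * Y ≤ (ωh - 2 * lam) * W := by
    have : (ωh - 2 * lam) * W = (ωh - 2 * lam) * W₀ + ωh * Y := by
      rw [hWdef]; field_simp
    nlinarith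
  have hγK : ∀ x, 2 * γ * ‖x‖ ^ 2 ≤ inner ℝ x (K x) := fun x => by simpa [hK] using hγ x
  have hev : ∀ᶠ δ : ℝ in 𝓝[>] 0, 0 < δ ∧ δ * lam ≤ 1 / 2 ∧ δ * (d₀ * lam) ≤ 1 / 2 ∧ δ * ωh ≤ 1 ∧
      δ * p ≤ 1 ∧ δ * ‖K‖ ^ 2 ≤ 2 * γ ∧ δ * γ ≤ 1 ∧ δ * (k * (G * Ξ)) ≤ 1 / 2 ∧
      δ * (k * (‖K‖ * (G * Ξ)) + lam * p + k * (G * q) + k * e * c) ≤ γ * (ρ₀ + 1) ∧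
      δ * ((2 * d₀ + 1) * (k * (2 * Y) * c)) ≤ 1 := by
    refine Eventually.and (eventually_mem_nhdsWithin) ?_
    repeat' refine Eventually.and (eventually_mul_le _ (by positivity)) ?_
    exact eventually_mul_le _ (by positivity)
  obtain ⟨δ, hδ, s1, s2, s3, s4, s5, s6, s7, s8, s9⟩ := hev.exists
  refine ⟨δ, hδ, R + 1, by rw [hR]; positivity, W + 1, by linarith, ?_⟩
  intro ε T S M z x w hε hεδ hεT hSδ hS hM hSM hrun hz₀ hw₀ j hj
  have := hrun.boundedUpTo hA hK hγK hγ0 hk hlam hωh hSM hS hM hSδ hz₀ (hw₀.trans hWW) hR hX hY hW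
    he₀ hp hq hΞ hG he hε hεδ hεT s1 (by linarith) s3 s4 s5 s6 s7 s8 s9 j hj
  exact ⟨(this.estimate j le_rfl).trans_lt (lt_add_one _),
    (this.filter j hj le_rfl).trans_lt (lt_add_one _)⟩

end NormalizedBound

/-! ### Trigonometric sums and the averages of the sinusoidal dither. -/

section Dither

open Finset

/-- Reflection turns the sum into minus the sum shifted by one, and the shift changes nothing since
`f T = f 0`. This disposes of the averages of odd order, including the cubic one, for which
orthogonality does not help. -/
theorem sum_range_eq_zero_of_odd {V : Type*} [AddCommGroup V] [Module ℝ V] (f : ℕ → V) (T : ℕ)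
    (hodd : ∀ j < T, f (T - 1 - j) = -f (j + 1)) (hT : f T = f 0) : ∑ j ∈ range T, f j = 0 := by
  have h1 : ∑ j ∈ range T, f (j + 1) = ∑ j ∈ range T, f j := by
    have := sum_range_succ' f T
    rw [sum_range_succ, hT] at this
    exact (add_right_cancel this).symm
  have h2 : ∑ j ∈ range T, f j = -∑ j ∈ range T, f j := by
    conv_lhs => rw [← sum_range_reflect]
    rw [sum_congr rfl fun j hj => hodd j (mem_range.1 hj), sum_neg_distrib, h1]
  have h3 : (2 : ℝ) • ∑ j ∈ range T, f j = 0 := by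
    rw [two_smul]; nth_rewrite 1 [h2]; exact neg_add_cancel _
  exact (smul_eq_zero.1 h3).resolve_left two_ne_zero

/-- Multiplication by `2 sin (x / 2)` makes the sum telescope; the bounds on `x` keep this factor
non-zero. -/
theorem sum_range_cos_eq_zero {x : ℝ} {T : ℕ} (m : ℤ) (hx : x * T = m * (2 * Real.pi))
    (hx0 : x ≠ 0) (hx1 : -(2 * Real.pi) < x) (hx2 : x < 2 * Real.pi) :
    ∑ j ∈ range T, Real.cos (x * j) = 0 := by
  have hs : Real.sin (x / 2) ≠ 0 := by
    rw [Ne, Real.sin_eq_zero_iff_of_lt_of_lt (by linarith) (by linarith)]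
    simpa using hx0
  have h : ∀ N : ℕ, 2 * Real.sin (x / 2) * ∑ j ∈ range N, Real.cos (x * j) =
      Real.sin (x * N - x / 2) + Real.sin (x / 2) := by
    intro N
    induction N with
    | zero => simp
    | succ N ih =>
      rw [sum_range_succ, mul_add, ih]
      have h1 : x * ((N + 1 : ℕ) : ℝ) - x / 2 = x * N + x / 2 := by push_cast; ring
      rw [h1, Real.sin_sub, Real.sin_add]
      ring
  have h2 := h T
  rw [hx, sub_eq_add_neg, add_comm (_ * _), Real.sin_add_int_mul_two_pi, Real.sin_neg,
    neg_add_cancel] at h2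
  exact (mul_eq_zero.1 h2).resolve_left (by simpa using hs)

/-- Product-to-sum formula. The condition `2 * n < T` excludes aliasing: sums and differences of the
frequencies stay strictly between `-2π` and `2π`. -/
theorem sum_range_sin_mul_sin {n T : ℕ} (hT : 2 * n < T) {ω : Fin n → ℝ}
    (hω : ∀ i, ω i * T = ((i : ℝ) + 1) * (2 * Real.pi)) (l i : Fin n) :
    ∑ j ∈ range T, Real.sin (ω l * j) * Real.sin (ω i * j) = if l = i then (T : ℝ) / 2 else 0 := by
  have hT0 : (0 : ℝ) < T := by exact_mod_cast (by omega : 0 < T)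
  have hpi := Real.pi_pos
  have hω' : ∀ i, ω i = ((i : ℝ) + 1) * (2 * Real.pi) / T := fun i => by
    rw [← hω i]; field_simp
  have hin : ∀ i : Fin n, (i : ℝ) + 1 ≤ n := fun i => by exact_mod_cast i.2
  have hi0 : ∀ i : Fin n, 0 ≤ (i : ℝ) := fun i => Nat.cast_nonneg _
  have hTn : 2 * (n : ℝ) < T := by exact_mod_cast hT
  have hpos : ∀ i, 0 < ω i := fun i => by
    rw [hω' i]; have := hi0 i; positivity
  have hprod : ∀ j : ℕ, Real.sin (ω l * j) * Real.sin (ω i * j) =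
      1 / 2 * Real.cos ((ω l - ω i) * j) - 1 / 2 * Real.cos ((ω l + ω i) * j) := fun j => by
    rw [sub_mul, add_mul, Real.cos_sub, Real.cos_add]; ring
  have hsum : ∑ j ∈ range T, Real.cos ((ω l + ω i) * j) = 0 := by
    refine sum_range_cos_eq_zero ((l : ℤ) + 1 + (i + 1)) ?_ ?_ ?_ ?_
    · rw [add_mul, hω, hω]; push_cast; ring
    · exact (add_pos (hpos l) (hpos i)).ne'
    · linarith [hpos l, hpos i]
    · rw [hω', hω', ← add_div, div_lt_iff₀ hT0]
      nlinarith [hin l, hin i]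
  rw [sum_congr rfl fun j _ => hprod j, sum_sub_distrib, ← mul_sum, ← mul_sum, hsum]
  split_ifs with hli
  · subst hli
    simp; ring
  · rw [sum_range_cos_eq_zero ((l : ℤ) - i)]
    · simp
    · rw [sub_mul, hω, hω]; push_cast; ring
    · rw [sub_ne_zero]
      intro h
      have h1 := hω l
      rw [h, hω i] at h1
      have h2 := mul_right_cancel₀ (by positivity) h1
      have h3 : (i : ℝ) = l := by linarith
      exact hli (Fin.ext (by exact_mod_cast h3.symm))
    · rw [hω', hω', ← sub_div, lt_div_iff₀ hT0]
      nlinarith [hin l, hin i, hi0 l, hi0 i]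
    · rw [hω', hω', ← sub_div, div_lt_iff₀ hT0]
      nlinarith [hin l, hin i, hi0 l, hi0 i]

theorem EuclideanSpace.norm_le_sum_abs {n : ℕ} (x : EuclideanSpace ℝ (Fin n)) :
    ‖x‖ ≤ ∑ i, |x i| := by
  rw [EuclideanSpace.norm_eq, Real.sqrt_le_iff]
  exact ⟨sum_nonneg fun _ _ => abs_nonneg _, sum_sq_le_sq_sum_of_nonneg fun _ _ => abs_nonneg _⟩

open UnbiasedES

variable {n : ℕ} (P : Tuning n)

theorem UnbiasedES.Tuning.norm_S_le (j : ℕ) : ‖P.S j‖ ≤ ∑ i, |P.a i| := by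
  refine (EuclideanSpace.norm_le_sum_abs _).trans (sum_le_sum fun i _ => ?_)
  simp only [Tuning.S, abs_mul]
  exact mul_le_of_le_one_right (abs_nonneg _) (Real.abs_sin_le_one _)

theorem UnbiasedES.Tuning.norm_M_le (j : ℕ) : ‖P.M j‖ ≤ ∑ i, |2 / P.a i| := by
  refine (EuclideanSpace.norm_le_sum_abs _).trans (sum_le_sum fun i _ => ?_)
  simp only [Tuning.M, abs_mul]
  exact mul_le_of_le_one_right (abs_nonneg _) (Real.abs_sin_le_one _)

theorem UnbiasedES.Tuning.norm_S_succ_sub_le (j : ℕ) :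
    ‖P.S (j + 1) - P.S j‖ ≤ ∑ i, |P.a i| * |P.ω i| := by
  refine (EuclideanSpace.norm_le_sum_abs _).trans (sum_le_sum fun i _ => ?_)
  simp only [Tuning.S, PiLp.sub_apply, ← mul_sub, abs_mul]
  refine mul_le_mul_of_nonneg_left ?_ (abs_nonneg _)
  have h := Real.abs_sin_sub_sin_le (P.ω i * (j + 1 : ℕ)) (P.ω i * j)
  refine h.trans (le_of_eq ?_)
  congr 1; push_cast; ring

/-- The linear and cubic averages vanish by oddness. The quadratic one is orthogonality of sines,
normalized by `(2 / a_i) * a_i * (T / 2) = T`. -/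
theorem UnbiasedES.Tuning.isDither {T : ℕ} (hT : 2 * n < T)
    (hω : ∀ i, P.ω i * T = ((i : ℝ) + 1) * (2 * Real.pi)) (ha : ∀ i, P.a i ≠ 0)
    (A : EuclideanSpace ℝ (Fin n) →L[ℝ] EuclideanSpace ℝ (Fin n)) : IsDither A T P.S P.M := by
  have hper : ∀ (i : Fin n) (j : ℕ), Real.sin (P.ω i * (j + T : ℕ)) = Real.sin (P.ω i * j) := by
    intro i j
    rw [Nat.cast_add, mul_add, hω]
    exact_mod_cast Real.sin_add_nat_mul_two_pi (P.ω i * j) (i + 1)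
  have hodd : ∀ (i : Fin n) (j : ℕ), j < T →
      Real.sin (P.ω i * (T - 1 - j : ℕ)) = -Real.sin (P.ω i * (j + 1 : ℕ)) := by
    intro i j hj
    have h1 : P.ω i * (T - 1 - j : ℕ) = ((i + 1 : ℕ) : ℝ) * (2 * Real.pi) -
        P.ω i * (j + 1 : ℕ) := by
      rw [Nat.sub_sub, Nat.cast_sub (by omega), mul_sub, hω]
      push_cast; ring
    rw [h1, Real.sin_nat_mul_two_pi_sub]
  have hS : ∀ j, P.S (j + T) = P.S j := fun j => by simp only [Tuning.S, hper]
  have hM : ∀ j, P.M (j + T) = P.M j := fun j => by simp only [Tuning.M, hper]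
  have hS' : ∀ j < T, P.S (T - 1 - j) = -P.S (j + 1) := fun j hj => by
    ext i; simp only [Tuning.S, hodd i j hj, PiLp.neg_apply]; ring
  have hM' : ∀ j < T, P.M (T - 1 - j) = -P.M (j + 1) := fun j hj => by
    ext i; simp only [Tuning.M, hodd i j hj, PiLp.neg_apply]; ring
  refine ⟨by omega, hS, hM, ?_, fun u => ?_, ?_⟩
  · exact sum_range_eq_zero_of_odd _ T hM' (by simpa using hM 0)
  · ext i
    have h1 : ∀ j, (inner ℝ (P.S j) u • P.M j) i =
        ∑ l, (2 / P.a i * P.a l * u l) * (Real.sin (P.ω l * j) * Real.sin (P.ω i * j)) := by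
      intro j
      simp only [PiLp.smul_apply, PiLp.inner_apply, Tuning.S, Tuning.M, smul_eq_mul, sum_mul]
      refine sum_congr rfl fun l _ => ?_
      simp; ring
    rw [WithLp.ofLp_sum, Finset.sum_apply, sum_congr rfl fun j _ => h1 j, sum_comm]
    simp_rw [← mul_sum, sum_range_sin_mul_sin hT hω]
    simp only [mul_ite, mul_zero, sum_ite_eq', mem_univ, if_true, PiLp.smul_apply, smul_eq_mul]
    have := ha i
    field_simp
  · refine sum_range_eq_zero_of_odd _ T (fun j hj => ?_) ?_
    · simp only [hS' j hj, hM' j hj, map_neg, inner_neg_neg, smul_neg]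
    · have h1 := hS 0
      have h2 := hM 0
      rw [zero_add] at h1 h2
      simp only [h1, h2]

end Dither

/-! ### From the algorithm to the scaled recursion. -/

section ExtremumSeeking

open UnbiasedES

theorem ContinuousLinearMap.exists_coercive_of_pos {E : Type*} [NormedAddCommGroup E]
    [InnerProductSpace ℝ E] [FiniteDimensional ℝ E] (K : E →L[ℝ] E)
    (hK : ∀ x ≠ 0, 0 < inner ℝ x (K x)) :
    ∃ γ > 0, ∀ x, 2 * γ * ‖x‖ ^ 2 ≤ inner ℝ x (K x) := by
  have : ProperSpace E := FiniteDimensional.proper ℝ E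
  have hcont : Continuous fun x => inner ℝ x (K x) := by fun_prop
  have hmin : ∃ c > 0, ∀ x, ‖x‖ = 1 → c ≤ inner ℝ x (K x) := by
    -- The unit sphere is empty when `E` is trivial, that is for `n = 0`.
    rcases (Metric.sphere (0 : E) 1).eq_empty_or_nonempty with he | hne
    · refine ⟨1, one_pos, fun x hx => ?_⟩
      have : x ∈ Metric.sphere (0 : E) 1 := by simpa using hx
      simp [he] at this
    · obtain ⟨y, hy, hmin⟩ := (isCompact_sphere (0 : E) 1).exists_isMinOn hne hcont.continuousOn
      refine ⟨_, hK y ?_, fun x hx => hmin (by simpa using hx)⟩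
      rintro rfl
      simp at hy
  obtain ⟨c, hc, h⟩ := hmin
  refine ⟨c / 2, by positivity, fun x => ?_⟩
  rcases eq_or_ne x 0 with rfl | hx
  · simp
  have hn : 0 < ‖x‖ := norm_pos_iff.2 hx
  have h1 := h (‖x‖⁻¹ • x) (by rw [norm_smul, norm_inv, norm_norm, inv_mul_cancel₀ hn.ne'])
  rw [map_smul, inner_smul_left, inner_smul_right] at h1
  simp only [conj_trivial] at h1
  have h2 : inner ℝ x (K x) = ‖x‖ ^ 2 * (‖x‖⁻¹ * (‖x‖⁻¹ * inner ℝ x (K x))) := by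
    field_simp
  rw [h2, mul_div_cancel₀ _ (two_ne_zero), mul_comm]
  gcongr

theorem UnbiasedES.wsq_eq_inner {n : ℕ} (H : Matrix (Fin n) (Fin n) ℝ)
    (x : EuclideanSpace ℝ (Fin n)) :
    wsq H x = inner ℝ x (Matrix.toEuclideanCLM (𝕜 := ℝ) H x) :=
  (Matrix.inner_toEuclideanCLM H x x).symm

theorem Matrix.IsHermitian.inner_toEuclideanCLM_comm {n : ℕ} {H : Matrix (Fin n) (Fin n) ℝ}
    (hH : H.IsHermitian) (x y : EuclideanSpace ℝ (Fin n)) :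
    inner ℝ (Matrix.toEuclideanCLM (𝕜 := ℝ) H x) y =
      inner ℝ x (Matrix.toEuclideanCLM (𝕜 := ℝ) H y) := by
  rw [real_inner_comm, Matrix.inner_toEuclideanCLM, Matrix.inner_toEuclideanCLM,
    Matrix.dotProduct_mulVec, ← Matrix.mulVec_transpose, dotProduct_comm]
  have : Hᵀ = H := by simpa [Matrix.IsHermitian] using hH
  rw [this]

theorem UnbiasedES.two_mul_lt_period (n d : ℕ) (ε : ℝ) : 2 * n < period n d ε :=
  lt_of_lt_of_le (Nat.lt_succ_self _) (le_max_right _ _)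

theorem UnbiasedES.frequency_mul_period (n d : ℕ) (ε : ℝ) (i : Fin n) :
    frequency n d ε i * period n d ε = ((i : ℝ) + 1) * (2 * Real.pi) := by
  have : (period n d ε : ℝ) ≠ 0 := by
    exact_mod_cast (lt_of_le_of_lt (Nat.zero_le _) (two_mul_lt_period n d ε)).ne'
  rw [frequency, div_mul_cancel₀ _ this]; ring

/-- For `ε ≤ 1` the floor of `1 / √ε` is at least half of `1 / √ε`, so `T ≥ n / (2√ε)`. This needs
`d ≥ 1`, whence `max D_M 1` in the period. -/
theorem UnbiasedES.abs_frequency_le {n d : ℕ} (hd : 1 ≤ d) {ε : ℝ} (hε : 0 < ε) (hε1 : ε ≤ 1)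
    (i : Fin n) : |frequency n d ε i| ≤ 4 * Real.pi * √ε := by
  have hs : 0 < √ε := Real.sqrt_pos.2 hε
  have hs1 : 1 ≤ 1 / √ε := by rw [le_div_iff₀ hs, one_mul]; exact Real.sqrt_le_one.2 hε1
  have hT0 : (0 : ℝ) < period n d ε := by
    exact_mod_cast lt_of_le_of_lt (Nat.zero_le _) (two_mul_lt_period n d ε)
  have hN1 : (1 : ℝ) ≤ ⌊1 / √ε⌋₊ := by exact_mod_cast Nat.le_floor (by simpa using hs1)
  have hN2 := Nat.lt_floor_add_one (1 / √ε)
  have hN3 : 1 ≤ 2 * √ε * ⌊1 / √ε⌋₊ := by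
    rw [div_lt_iff₀ hs] at hN2
    nlinarith
  have hT : ((n : ℝ) * d * ⌊1 / √ε⌋₊) ≤ period n d ε := by
    exact_mod_cast le_max_left _ _
  have hin : (i : ℝ) + 1 ≤ n := by exact_mod_cast i.2
  have hd' : (1 : ℝ) ≤ d := by exact_mod_cast hd
  have hpi := Real.pi_pos
  have hi0 : (0 : ℝ) ≤ i := Nat.cast_nonneg _
  rw [frequency, abs_of_nonneg (by positivity), div_le_iff₀ hT0]
  have h1 : (i : ℝ) + 1 ≤ 2 * √ε * period n d ε := by
    calc (i : ℝ) + 1 ≤ n := hin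
      _ = n * 1 * 1 := by ring
      _ ≤ n * d * (2 * √ε * ⌊1 / √ε⌋₊) := by gcongr
      _ = 2 * √ε * (n * d * ⌊1 / √ε⌋₊) := by ring
      _ ≤ _ := by gcongr
  nlinarith

/-- The opposite requirement: the period may not be too long, since the averaging correction is of
size `εT`. -/
theorem UnbiasedES.mul_period_le (n d : ℕ) {ε : ℝ} (hε : 0 < ε) :
    ε * period n d ε ≤ n * d * √ε + ε * (2 * n + 1) := by
  have hs : 0 < √ε := Real.sqrt_pos.2 hε
  have hT : (period n d ε : ℝ) ≤ n * d * (1 / √ε) + (2 * n + 1) := by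
    have h1 : period n d ε ≤ n * d * ⌊1 / √ε⌋₊ + (2 * n + 1) :=
      max_le (Nat.le_add_right _ _) (Nat.le_add_left _ _)
    have h2 : (period n d ε : ℝ) ≤ n * d * ⌊1 / √ε⌋₊ + (2 * n + 1) := by exact_mod_cast h1
    have h3 := Nat.floor_le (by positivity : 0 ≤ 1 / √ε)
    exact h2.trans (by gcongr)
  calc ε * period n d ε ≤ ε * (n * d * (1 / √ε) + (2 * n + 1)) := by gcongr
    _ = n * d * (ε / √ε) + ε * (2 * n + 1) := by ring
    _ = _ := by rw [Real.div_sqrt]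

variable {n : ℕ} {P : Tuning n}

/-- The output error carries `α²`, which cancels the `1 / α` of the update after division by `α`.
The factors `1 - ελ` and `(1 - ελ) ^ 2` come from `α (j + 1) = α j * rate`, and the power in
`sample` from `α j = α (j - D j) * rate ^ D j`. -/
theorem UnbiasedES.Tuning.IsTrajectory.isNormalizedRun {F : QuadMap n} {D : ℕ → ℕ}
    (hD : ∀ j, D j ≤ P.D_M) {θ₀ : EuclideanSpace ℝ (Fin n)} {Q₀ : ℝ}
    {θhat : ℕ → EuclideanSpace ℝ (Fin n)} {η : ℕ → ℝ} (h : P.IsTrajectory F D θ₀ Q₀ θhat η)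
    (hα₀ : 0 < P.α₀) (hr : 0 < P.rate) :
    IsNormalizedRun (Matrix.toEuclideanCLM (𝕜 := ℝ) F.H) P.k P.lam P.ωh P.ε P.D_M P.S P.M
      (fun j => (P.α j)⁻¹ • (θhat j - F.θs))
      (fun j => (P.α j)⁻¹ • (P.input θ₀ θhat (j - D j) - F.θs))
      (fun j => (η j - F.Qs) / P.α j ^ 2) := by
  have hα : ∀ j, P.α j ≠ 0 := fun j => (mul_pos hα₀ (pow_pos hr j)).ne'
  have hαs : ∀ j, P.α (j + 1) = P.α j * P.rate := fun j => by
    simp only [Tuning.α, pow_succ, mul_assoc]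
  have hrate : 1 - P.ε * P.lam = P.rate := rfl
  have hr0 := hr.ne'
  have hy : ∀ j ≥ P.D_M, P.output F D θ₀ θhat j = F.Qs + P.α j ^ 2 * (1 / 2 *
      inner ℝ ((P.α j)⁻¹ • (P.input θ₀ θhat (j - D j) - F.θs))
        (Matrix.toEuclideanCLM (𝕜 := ℝ) F.H
          ((P.α j)⁻¹ • (P.input θ₀ θhat (j - D j) - F.θs)))) := by
    intro j hj
    have := hα j
    rw [Tuning.output, if_neg (not_lt.2 hj), QuadMap.eval, wsq_eq_inner, map_smul,
      inner_smul_left, inner_smul_right]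
    simp only [conj_trivial]
    field_simp
  refine ⟨fun j hj => ?_, fun j hj => ?_, fun j hj => ⟨D j, hD j, ?_⟩⟩
  · have := hα j
    rw [hrate, hαs, h.θhat_step j hj, hy j hj, smul_smul, mul_inv, mul_comm (P.α j)⁻¹,
      mul_inv_cancel_left₀ hr0, sub_right_comm, smul_sub, smul_smul]
    congr 2
    field_simp
    ring
  · have := hα j
    rw [hrate, hαs, h.η_step j hj, hy j hj]
    field_simp
    ring
  · have hle : D j ≤ j := (hD j).trans hj
    have hαd : P.rate ^ D j * (P.α j)⁻¹ = (P.α (j - D j))⁻¹ := by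
      have h1 : P.α j = P.α (j - D j) * P.rate ^ D j := by
        simp only [Tuning.α]
        rw [mul_assoc, ← pow_add, Nat.sub_add_cancel hle]
      have := hα (j - D j)
      rw [h1]
      field_simp
    simp only [hrate]
    rw [smul_smul, hαd, Tuning.input]
    split_ifs with hjd
    · rw [h.θhat_init _ hjd, add_zero]
    · rw [add_sub_right_comm, smul_add, smul_smul, inv_mul_cancel₀ (hα _), one_smul]

theorem UnbiasedES.Tuning.IsTrajectory.initial_bounds {F : QuadMap n} {D : ℕ → ℕ}
    {θ₀ : EuclideanSpace ℝ (Fin n)} {Q₀ σ₀ ΔQ : ℝ}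
    {θhat : ℕ → EuclideanSpace ℝ (Fin n)} {η : ℕ → ℝ} (h : P.IsTrajectory F D θ₀ Q₀ θhat η)
    (hα₀ : 0 < P.α₀) (hr : ∀ j ≤ P.D_M, 1 / 2 ≤ P.rate ^ j)
    (hθ : ‖θ₀ - F.θs‖ ≤ σ₀) (hQ : |Q₀ - F.Qs| ≤ ΔQ) :
    (∀ j ≤ P.D_M, ‖(P.α j)⁻¹ • (θhat j - F.θs)‖ ≤ 2 * σ₀ / P.α₀) ∧
      |(η P.D_M - F.Qs) / P.α P.D_M ^ 2| ≤ 4 * ΔQ / P.α₀ ^ 2 := by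
  have hα : ∀ j ≤ P.D_M, P.α₀ / 2 ≤ P.α j := fun j hj => by
    rw [Tuning.α]; nlinarith [hr j hj]
  have hσ₀ : 0 ≤ σ₀ := (norm_nonneg _).trans hθ
  have hΔQ : 0 ≤ ΔQ := (abs_nonneg _).trans hQ
  constructor
  · intro j hj
    have hp : 0 < P.α j := lt_of_lt_of_le (by positivity) (hα j hj)
    rw [h.θhat_init j hj, norm_smul, Real.norm_of_nonneg (by positivity)]
    calc (P.α j)⁻¹ * ‖θ₀ - F.θs‖ ≤ (P.α₀ / 2)⁻¹ * σ₀ := by gcongr; exact hα j hj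
      _ = _ := by rw [inv_div]; ring
  · have hp := hα _ le_rfl
    rw [h.η_init, abs_div, abs_of_nonneg (sq_nonneg (P.α P.D_M))]
    calc |Q₀ - F.Qs| / P.α P.D_M ^ 2 ≤ ΔQ / (P.α₀ / 2) ^ 2 := by gcongr
      _ = _ := by field_simp; ring

end ExtremumSeeking

/-! ### Conclusion: frequency asymptotics and exponential stability. -/

theorem UnbiasedES.frequency_isBigO (n : ℕ) {d : ℕ} (hd : 1 ≤ d) (i : Fin n) :
    (fun ε : ℝ => frequency n d ε i) =O[𝓝[>] 0] fun ε : ℝ => √ε := by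
  refine IsBigO.of_bound (4 * Real.pi) ?_
  filter_upwards [Ioc_mem_nhdsGT (zero_lt_one' ℝ)] with ε hε
  rw [Real.norm_eq_abs, Real.norm_of_nonneg (Real.sqrt_nonneg _)]
  exact abs_frequency_le hd hε.1 hε.2 i

theorem corollary1 (n D_M : ℕ)
    (H : Matrix (Fin n) (Fin n) ℝ) (hH : H.PosDef)
    (σ₀ ΔQ : ℝ) (hσ₀ : 0 < σ₀) (hΔQ : 0 < ΔQ)
    (a : Fin n → ℝ) (ha : ∀ i, a i ≠ 0)
    (α₀ k lam ωh : ℝ) (hα₀ : 0 < α₀) (hk : 0 < k) (hlam : 0 < lam) (hωh : 0 < ωh)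
    (hkH : (k • H - lam • (1 : Matrix (Fin n) (Fin n) ℝ)).PosDef) (hωlam : 2 * lam < ωh) :
    (∀ i : Fin n,
      (fun ε : ℝ => UnbiasedES.frequency n (max D_M 1) ε i) =O[𝓝[>] 0] fun ε : ℝ => √ε) ∧
    ∃ εs : ℝ, 0 < εs ∧ ∃ σ ση : ℝ, 0 < σ ∧ 0 < ση ∧
      ∀ ε : ℝ, 0 < ε → ε ≤ εs →
        UnbiasedES.Tuning.IsExpStable
          { D_M := D_M, a := a, ω := UnbiasedES.frequency n (max D_M 1) ε,
            α₀ := α₀, k := k, lam := lam, ωh := ωh, ε := ε }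
          H σ₀ ΔQ σ ση := by
  have hd : 1 ≤ max D_M 1 := le_max_right _ _
  refine ⟨UnbiasedES.frequency_isBigO n hd, ?_⟩
  set d := max D_M 1
  set A := Matrix.toEuclideanCLM (𝕜 := ℝ) H with hA
  obtain ⟨γ, hγ0, hγ⟩ := ContinuousLinearMap.exists_coercive_of_pos
    (Matrix.toEuclideanCLM (𝕜 := ℝ) (k • H - lam • (1 : Matrix (Fin n) (Fin n) ℝ)))
    fun x hx => by
      rw [Matrix.inner_toEuclideanCLM]
      exact hkH.dotProduct_mulVec_pos (x := x.ofLp) (by simpa using hx)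
  have hγ' : ∀ x, 2 * γ * ‖x‖ ^ 2 ≤ inner ℝ x (k • A x - lam • x) := fun x => by
    simpa [hA] using hγ x
  obtain ⟨δ, hδ, R, hR, W, hW, hrun⟩ := exists_bounds_of_isNormalizedRun A
    hH.isHermitian.inner_toEuclideanCLM_comm hγ0 hγ' hk.le hlam.le hωlam D_M
    (b := ∑ i, |a i|) (c := ∑ i, |2 / a i|) (ρ₀ := 2 * σ₀ / α₀) (W₀ := 4 * ΔQ / α₀ ^ 2)
    (by positivity) (by positivity)
  have hlim : ∀ {f : ℝ → ℝ}, Continuous f → f 0 = 0 → ∀ {B : ℝ}, 0 < B →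
      ∀ᶠ ε : ℝ in 𝓝[>] 0, f ε ≤ B := fun hf h0 B hB =>
    ((hf.tendsto' 0 0 h0).mono_left nhdsWithin_le_nhds).eventually (ge_mem_nhds hB)
  -- The third and fourth bounds dominate `εT` and the dither increments; the last two keep the gain
  -- above `α₀ / 2` up to time `D_M`.
  have hev : ∀ᶠ ε : ℝ in 𝓝[>] 0, ε ≤ 1 ∧ ε ≤ δ ∧ n * d * √ε + ε * (2 * n + 1) ≤ δ ∧
      (∑ i, |a i|) * (4 * Real.pi * √ε) ≤ δ ∧ ε * lam ≤ 1 / 2 ∧ D_M * (ε * lam) ≤ 1 / 2 :=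
    (hlim continuous_id rfl one_pos).and <| (hlim continuous_id rfl hδ).and <|
      (hlim (by fun_prop) (by simp) hδ).and <| (hlim (by fun_prop) (by simp) hδ).and <|
      (hlim (by fun_prop) (by simp) one_half_pos).and
        (hlim (by fun_prop) (by simp) one_half_pos)
  obtain ⟨εs, hεs, hsub⟩ := mem_nhdsGT_iff_exists_Ioc_subset.1 hev
  -- Undoing the scaling by `α = α₀ rate ^ j` and by `α ^ 2`.
  refine ⟨εs, hεs, α₀ * R, α₀ ^ 2 * W, by positivity, by positivity, fun ε hε hεle => ?_⟩
  obtain ⟨h1, h2, h3, h4, h5, h6⟩ := hsub ⟨hε, hεle⟩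
  set P : UnbiasedES.Tuning n :=
    { D_M := D_M, a := a, ω := UnbiasedES.frequency n d ε,
      α₀ := α₀, k := k, lam := lam, ωh := ωh, ε := ε }
  have hεlam : 0 < ε * lam := by positivity
  have hr : 0 < P.rate := by change 0 < 1 - ε * lam; linarith
  refine ⟨hr, by change 1 - ε * lam < 1; linarith, ?_⟩
  intro F hF D hD θ₀ Q₀ hθ hQ θhat η htraj j hj
  have hdither := P.isDither (UnbiasedES.two_mul_lt_period n d ε)
    (UnbiasedES.frequency_mul_period n d ε) ha A
  have hslew : ∀ j, ‖P.S (j + 1) - P.S j‖ ≤ δ := fun j => by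
    refine (P.norm_S_succ_sub_le j).trans (le_trans ?_ h4)
    rw [Finset.sum_mul]
    exact Finset.sum_le_sum fun i _ => mul_le_mul_of_nonneg_left
      (UnbiasedES.abs_frequency_le hd hε h1 i) (abs_nonneg _)
  have hinit := htraj.initial_bounds hα₀
    (fun i hi => (one_sub_mul_pow_bounds hεlam.le hi h5 h6).1) hθ hQ
  have hnorm := htraj.isNormalizedRun hD hα₀ hr
  rw [hF] at hnorm
  have hb := hrun ε (UnbiasedES.period n d ε) P.S P.M _ _ _ hε h2
    ((UnbiasedES.mul_period_le n d hε).trans h3) hslew P.norm_S_le P.norm_M_le hdither hnorm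
    hinit.1 hinit.2 j hj
  have hα : 0 < P.α j := mul_pos hα₀ (pow_pos hr j)
  have hb1 := hb.1
  have hb2 := hb.2
  rw [norm_smul, norm_inv, Real.norm_of_nonneg hα.le, inv_mul_lt_iff₀ hα] at hb1
  rw [abs_div, abs_of_nonneg (sq_nonneg (P.α j)), div_lt_iff₀ (by positivity)] at hb2
  refine ⟨hb1.trans_eq ?_, hb2.trans_eq ?_⟩
  · change α₀ * P.rate ^ j * R = _; ring
  · change W * (α₀ * P.rate ^ j) ^ 2 = _; ring
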